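/- All graphs are finite and simple. For a graph $G=(V,E)$, a labeling $f:E\to\mathbb{Z}_2=\{0,1\}$ is \emph{edge-friendly} if $|e_f(0)-e_f(1)|\le 1$, where $e_f(i)$ is the number of edges with label $i$. For $v\in V$ let $\deg_i(v)$ be the number of edges at $v$ with label $i$. The labeling $f$ induces a partial vertex labeling $f^+$: $f^+(v)=0$ if $\deg_0(v)>\deg_1(v)$, $f^+(v)=1$ if $\deg_1(v)>\deg_0(v)$, and $f^+(v)$ is undefined if $\deg_0(v)=\deg_1(v)$. Let $v_f(i)$ be the number of vertices $v$ with $f^+(v)=i$. The \emph{edge-balanced index set} of $G$ is \[EBI(G)=\{\,|v_f(0)-v_f(1)| : f \text{ is an edge-friendly labeling of } G\,\}.\] The direct product $G\times H$ has vertex set $V(G)\times V(H)$, and $(u_1,v_1)$ and $(u_2,v_2)$ are adjacent if and only if $u_1u_2\in E(G)$ and $v_1v_2\in E(H)$; thus $K_n\times K_2$ is the crown graph. \textbf{Theorem.} For every positive even integer $n$, \[EBI(K_n\times K_2)=\{0,2,4,\dots,2n-4\},\] the set of all even integers $k$ with $0\le k\le 2n-4$. For every odd integer $n>3$, \[EBI(K_n\times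 K_2)=\{0,1,2,\dots,2n-8\},\] the set of all integers $k$ with $0\le k\le 2n-8$. -/

import Mathlib

namespace SimpleGraph

/-- The direct (Kronecker) product of two simple graphs: `(u₁, v₁)` and `(u₂, v₂)` are adjacent
iff `u₁ ~ u₂` in the first graph and `v₁ ~ v₂` in the second. -/
def directProd {V W : Type*} (G : SimpleGraph V) (H : SimpleGraph W) : SimpleGraph (V × W) where
  Adj x y := G.Adj x.1 y.1 ∧ H.Adj x.2 y.2
  symm := ⟨fun _ _ h => ⟨h.1.symm, h.2.symm⟩⟩
  loopless := ⟨fun x h => G.loopless.irrefl x.1 h.1⟩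

/-- A binary labeling of the edges of `G`. -/
abbrev BinaryEdgeLabeling {V : Type*} (G : SimpleGraph V) : Type _ := G.edgeSet → ZMod 2

namespace BinaryEdgeLabeling

variable {V : Type*} {G : SimpleGraph V}

/-- The number `e_f(i)` of edges with label `i`. -/
noncomputable def edgeCount (f : G.BinaryEdgeLabeling) (i : ZMod 2) : ℕ :=
  {e : G.edgeSet | f e = i}.ncard

/-- The labeling is edge-friendly: `|e_f(0) - e_f(1)| ≤ 1`. -/
def IsEdgeFriendly (f : G.BinaryEdgeLabeling) : Prop :=
  |(f.edgeCount 0 : ℤ) - (f.edgeCount 1 : ℤ)| ≤ 1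

/-- The set `N_i(v)` of the neighbours of `v` along edges with label `i`. -/
def labelNeighborSet (f : G.BinaryEdgeLabeling) (i : ZMod 2) (v : V) : Set V :=
  {u | ∃ h : G.Adj v u, f ⟨s(v, u), G.mem_edgeSet.mpr h⟩ = i}

/-- The `i`-degree of `v`. -/
noncomputable def labelDegree (f : G.BinaryEdgeLabeling) (i : ZMod 2) (v : V) : ℕ :=
  (f.labelNeighborSet i v).ncard

/-- The induced partial vertex labeling `f⁺`; the value `none` means that `v` is unlabeled. -/
noncomputable def vertexLabel (f : G.BinaryEdgeLabeling) (v : V) : Option (ZMod 2) :=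
  if f.labelDegree 1 v < f.labelDegree 0 v then some 0
  else if f.labelDegree 0 v < f.labelDegree 1 v then some 1
  else none

/-- The number `v_f(i)` of vertices whose induced label is `i`. -/
noncomputable def vertexCount (f : G.BinaryEdgeLabeling) (i : ZMod 2) : ℕ :=
  {v : V | f.vertexLabel v = some i}.ncard

end BinaryEdgeLabeling

/-- The edge-balanced index set of a finite graph `G`: all values `|v_f(0) - v_f(1)|`, where `f`
runs over the edge-friendly labelings of `G`. -/
def edgeBalancedIndexSet {V : Type*} [Finite V] (G : SimpleGraph V) : Set ℤ :=
  {k | ∃ f : G.BinaryEdgeLabeling, f.IsEdgeFriendly ∧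
    k = |(f.vertexCount 0 : ℤ) - (f.vertexCount 1 : ℤ)|}

end SimpleGraph

/-!
A labeling of the crown graph `K_n × K_2` is encoded by its signed matrix: an `n × n` integer matrix
with zero diagonal, whose `(i, j)` entry is `1` or `-1` according to the label of the edge from
`(i, 0)` to `(j, 1)`. Row and column sums are the differences `deg₁ - deg₀` at the two kinds of
vertices, the labeling is edge-friendly exactly when all entries sum to `0`, and `v_f(1) - v_f(0)`
is the imbalance of the matrix, the sum of the signs of its row and column sums
(`edgeBalancedIndexSet_crown`).

*Upper bound.* It suffices to bound the sum of the signs of the row sums of a balanced matrix. For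
even `n` all row sums are odd, and one of them must be negative
(`IsSigned.rowImbalance_le_of_even`). For odd `n` they are even, so `P` positive row sums contribute
at least `2 P` and `N` negative ones at least `-(n - 1) N`; hence `N ≥ 2`, unless `P` is small
anyway (`IsSigned.rowImbalance_le_of_odd`).

*Realization.* The bound is attained by a matrix built around a circulant
(`exists_extremal_of_even`, `exists_extremal_of_odd`). Exchanging two entries of one row leaves all
row sums unchanged and moves two column sums in opposite directions, so it changes the imbalance by
at most `2`, and by at most `1` if `n` is odd (`Step.abs_imbalance_sub`). Such exchanges, in rows
and in columns, connect any two balanced matrices (`reach_of_sum_eq`). A chain of them from an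
extremal matrix `x` to `-x` takes the imbalance from its maximum to the opposite value, and by a
discrete intermediate value argument it meets every integer in between, or every even integer if
`n` is even, when the imbalance is always even.
-/

namespace CrownGraph

open Finset SimpleGraph

variable {n : ℕ}

/-! ### Signed matrices -/

/-- A signed crown matrix: the `(i, j)` entry is `1` or `-1` according to the label of the edge
joining `(i, 0)` to `(j, 1)`; the diagonal, where there is no edge, is `0`. -/
structure IsSigned (x : Fin n × Fin n → ℤ) : Prop where
  diag : ∀ i, x (i, i) = 0
  offDiag : ∀ i j, i ≠ j → x (i, j) = 1 ∨ x (i, j) = -1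

/-- The sum of the `i`-th row. Column sums are row sums of the transpose `x ∘ Prod.swap`. -/
def rowSum (x : Fin n × Fin n → ℤ) (i : Fin n) : ℤ := ∑ j, x (i, j)

/-- The number of rows with positive sum minus the number of rows with negative sum. -/
def rowImbalance (x : Fin n × Fin n → ℤ) : ℤ := ∑ i, (rowSum x i).sign

/-- The number of rows and columns with positive sum minus the number of those with negative
sum. -/
def imbalance (x : Fin n × Fin n → ℤ) : ℤ := rowImbalance x + rowImbalance (x ∘ Prod.swap)

lemma IsSigned.transpose {x : Fin n × Fin n → ℤ} (hx : IsSigned x) :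
    IsSigned (x ∘ Prod.swap) :=
  ⟨hx.diag, fun i j h => hx.offDiag j i h.symm⟩

lemma IsSigned.neg {x : Fin n × Fin n → ℤ} (hx : IsSigned x) : IsSigned (-x) :=
  ⟨fun i => by simp [hx.diag], fun i j h => by
    rcases hx.offDiag i j h with h | h <;> simp [h]⟩

lemma imbalance_transpose (x : Fin n × Fin n → ℤ) : imbalance (x ∘ Prod.swap) = imbalance x := by
  have : (x ∘ Prod.swap) ∘ Prod.swap = x := by ext; simp
  rw [imbalance, imbalance, this, add_comm]

lemma rowImbalance_neg (x : Fin n × Fin n → ℤ) : rowImbalance (-x) = -rowImbalance x := by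
  simp [rowImbalance, rowSum]

lemma imbalance_neg (x : Fin n × Fin n → ℤ) : imbalance (-x) = -imbalance x := by
  have : (-x) ∘ Prod.swap = -(x ∘ Prod.swap) := rfl
  rw [imbalance, this, rowImbalance_neg, rowImbalance_neg, imbalance]; ring

lemma sum_rowSum (x : Fin n × Fin n → ℤ) : ∑ i, rowSum x i = ∑ p, x p := by
  rw [Fintype.sum_prod_type]; rfl

lemma sum_transpose (x : Fin n × Fin n → ℤ) : ∑ p, (x ∘ Prod.swap) p = ∑ p, x p :=
  (Equiv.prodComm (Fin n) (Fin n)).sum_comp x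

lemma sum_eq_card_sub_card {α : Type*} [Fintype α] (g : α → ℤ)
    (hg : ∀ a, g a = 0 ∨ g a = 1 ∨ g a = -1) :
    ∑ a, g a = (#{a | g a = 1} : ℤ) - #{a | g a = -1} := by
  rw [natCast_card_filter, natCast_card_filter, ← sum_sub_distrib]
  refine sum_congr rfl fun a _ => ?_
  rcases hg a with h | h | h <;> simp [h]

lemma IsSigned.values {x : Fin n × Fin n → ℤ} (hx : IsSigned x) (p : Fin n × Fin n) :
    x p = 0 ∨ x p = 1 ∨ x p = -1 := by
  obtain ⟨i, j⟩ := p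
  by_cases h : i = j
  · subst h; exact Or.inl (hx.diag i)
  · exact Or.inr (hx.offDiag i j h)

lemma IsSigned.card_add_card {x : Fin n × Fin n → ℤ} (hx : IsSigned x) (i : Fin n) :
    #{j | x (i, j) = 1} + #{j | x (i, j) = -1} + 1 = n := by
  rw [← card_union_of_disjoint]
  · have : (({j | x (i, j) = 1} : Finset (Fin n)) ∪ ({j | x (i, j) = -1} : Finset (Fin n))) =
        univ.erase i := by
      ext j
      simp only [mem_union, mem_filter, mem_univ, true_and, mem_erase, and_true]
      constructor
      · rintro h rfl
        simp [hx.diag] at h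
      · exact fun h => hx.offDiag i j (Ne.symm h)
    rw [this, card_erase_of_mem (mem_univ i), card_univ, Fintype.card_fin]
    have := i.pos
    omega
  · rw [disjoint_filter]
    intro j _ h
    omega

lemma IsSigned.rowSum_eq {x : Fin n × Fin n → ℤ} (hx : IsSigned x) (i : Fin n) :
    rowSum x i = (#{j | x (i, j) = 1} : ℤ) - #{j | x (i, j) = -1} :=
  sum_eq_card_sub_card _ fun _ => hx.values _

lemma IsSigned.rowSum_eq_two_mul {x : Fin n × Fin n → ℤ} (hx : IsSigned x) (i : Fin n) :
    rowSum x i = 2 * #{j | x (i, j) = 1} - (n - 1) := by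
  have := hx.rowSum_eq i
  have := hx.card_add_card i
  omega

/-! ### Bounds on the imbalance -/

lemma IsSigned.rowSum_even {x : Fin n × Fin n → ℤ} (hx : IsSigned x) (hn : Odd n) (i : Fin n) :
    Even (rowSum x i) := by
  obtain ⟨m, rfl⟩ := hn
  rw [hx.rowSum_eq_two_mul]
  exact ⟨#{j | x (i, j) = 1} - m, by push_cast; ring⟩

lemma IsSigned.rowSum_odd {x : Fin n × Fin n → ℤ} (hx : IsSigned x) (hn : Even n) (i : Fin n) :
    Odd (rowSum x i) := by
  obtain ⟨m, rfl⟩ := hn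
  rw [hx.rowSum_eq_two_mul]
  exact ⟨#{j | x (i, j) = 1} - m, by push_cast; ring⟩

/-- The total of a signed matrix has the parity of its `n (n - 1)` nonzero entries. -/
lemma IsSigned.sum_even {x : Fin n × Fin n → ℤ} (hx : IsSigned x) : Even (∑ p, x p) := by
  rw [← sum_rowSum]
  rcases Nat.even_or_odd n with hn | hn
  · obtain ⟨m, hm⟩ := hn
    choose t ht using hx.rowSum_odd ⟨m, hm⟩
    refine ⟨∑ i, t i + m, ?_⟩
    simp_rw [ht, sum_add_distrib, ← mul_sum]
    simp only [sum_const, card_univ, Fintype.card_fin, hm]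
    ring
  · exact even_sum _ fun i _ => hx.rowSum_even hn i

lemma IsSigned.rowImbalance_le_of_even {x : Fin n × Fin n → ℤ} (hx : IsSigned x) (hn : Even n)
    (h0 : 0 < n) (hs : ∑ p, x p = 0) : rowImbalance x ≤ n - 2 := by
  -- some row has a nonpositive, hence negative, sum
  obtain ⟨i, -, hi⟩ : ∃ i ∈ univ, rowSum x i ≤ 0 := by
    have : Nonempty (Fin n) := ⟨⟨0, h0⟩⟩
    refine exists_le_of_sum_le univ_nonempty ?_
    rw [sum_rowSum, hs, sum_const_zero]
  have hneg : (rowSum x i).sign = -1 := by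
    obtain ⟨t, ht⟩ := hx.rowSum_odd hn i
    exact Int.sign_eq_neg_one_of_neg (by omega)
  have hle : ∑ j ∈ univ.erase i, (rowSum x j).sign ≤ ∑ j ∈ univ.erase i, (1 : ℤ) :=
    sum_le_sum fun j _ => by rcases Int.sign_trichotomy (rowSum x j) with h | h | h <;> omega
  rw [rowImbalance, ← add_sum_erase _ _ (mem_univ i), hneg]
  rw [sum_const, card_erase_of_mem (mem_univ i), card_univ, Fintype.card_fin] at hle
  simp only [nsmul_eq_mul, mul_one] at hle
  omega

/-- With `P` positive and `N` negative row sums, the balance condition gives `2 P ≤ (n - 1) N`,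
since a positive row sum is at least `2` and a negative one at least `-(n - 1)`. -/
lemma IsSigned.rowImbalance_le_of_odd {x : Fin n × Fin n → ℤ} (hx : IsSigned x) (hn : Odd n)
    (h3 : 3 < n) (hs : ∑ p, x p = 0) : rowImbalance x ≤ n - 4 := by
  set P := #{i | (rowSum x i).sign = 1} with hP
  set N := #{i | (rowSum x i).sign = -1} with hN
  have himb : rowImbalance x = (P : ℤ) - N :=
    sum_eq_card_sub_card _ fun i => by
      rcases Int.sign_trichotomy (rowSum x i) with h | h | h <;> simp [h]
  have hPN : P + N ≤ n := by
    rw [hP, hN, ← card_union_of_disjoint]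
    · exact (card_le_univ _).trans_eq (Fintype.card_fin n)
    · rw [disjoint_filter]
      intro j _ h
      omega
  have hle : ∑ i, (2 * (if (rowSum x i).sign = 1 then 1 else 0) -
      (n - 1) * (if (rowSum x i).sign = -1 then 1 else 0) : ℤ) ≤ ∑ i, rowSum x i := by
    refine sum_le_sum fun i _ => ?_
    obtain ⟨t, ht⟩ := hx.rowSum_even hn i
    have h1 := hx.rowSum_eq_two_mul i
    rcases lt_trichotomy (rowSum x i) 0 with h | h | h
    · rw [Int.sign_eq_neg_one_of_neg h]
      norm_num
      omega
    · simp [h]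
    · rw [Int.sign_eq_one_of_pos h]
      norm_num
      omega
  rw [sum_sub_distrib, ← mul_sum, ← mul_sum, ← natCast_card_filter, ← natCast_card_filter,
    sum_rowSum, hs, ← hP, ← hN] at hle
  obtain ⟨m, hm⟩ := hn
  rw [himb]
  -- `P + N ≤ n` settles `N ≥ 2`; otherwise `P ≤ (n - 1) / 2 * N` and `n ≥ 5` are enough
  rcases Nat.lt_or_ge N 2 with h | h
  · interval_cases N
    · omega
    · omega
  · omega

/-! ### Swapping the labels of two edges with a common endpoint -/

/-- `y` arises from the signed matrix `x` by exchanging two off-diagonal entries which lie in the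
same row or in the same column. -/
def Step (x y : Fin n × Fin n → ℤ) : Prop :=
  IsSigned x ∧ ∃ p q : Fin n × Fin n, p.1 ≠ p.2 ∧ q.1 ≠ q.2 ∧ (p.1 = q.1 ∨ p.2 = q.2) ∧
    y = x ∘ Equiv.swap p q

lemma IsSigned.comp_swap {x : Fin n × Fin n → ℤ} (hx : IsSigned x) {p q : Fin n × Fin n}
    (hp : p.1 ≠ p.2) (hq : q.1 ≠ q.2) : IsSigned (x ∘ Equiv.swap p q) := by
  constructor
  · intro i
    rw [Function.comp_apply, Equiv.swap_apply_of_ne_of_ne, hx.diag]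
    · rintro rfl; exact hp rfl
    · rintro rfl; exact hq rfl
  · intro i j hij
    simp only [Function.comp_apply, Equiv.swap_apply_def]
    split_ifs
    · exact hx.offDiag _ _ hq
    · exact hx.offDiag _ _ hp
    · exact hx.offDiag _ _ hij

lemma Step.isSigned {x y : Fin n × Fin n → ℤ} (h : Step x y) : IsSigned y := by
  obtain ⟨hx, p, q, hp, hq, -, rfl⟩ := h
  exact hx.comp_swap hp hq

lemma Step.sum_eq {x y : Fin n × Fin n → ℤ} (h : Step x y) : ∑ p, y p = ∑ p, x p := by
  obtain ⟨-, p, q, -, -, -, rfl⟩ := h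
  exact Equiv.sum_comp (Equiv.swap p q) x

lemma isSigned_and_sum_eq_of_reach {x y : Fin n × Fin n → ℤ} (hx : IsSigned x)
    (h : Relation.ReflTransGen Step x y) : IsSigned y ∧ ∑ p, y p = ∑ p, x p := by
  induction h with
  | refl => exact ⟨hx, rfl⟩
  | tail _ h ih => exact ⟨h.isSigned, h.sum_eq.trans ih.2⟩

lemma sign_cases (c : ℤ) :
    (c < 0 ∧ c.sign = -1) ∨ (c = 0 ∧ c.sign = 0) ∨ (0 < c ∧ c.sign = 1) := by
  rcases lt_trichotomy c 0 with h | h | h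
  · exact .inl ⟨h, Int.sign_eq_neg_one_of_neg h⟩
  · exact .inr (.inl ⟨h, by rw [h, Int.sign_zero]⟩)
  · exact .inr (.inr ⟨h, Int.sign_eq_one_of_pos h⟩)

/-- If `C` and `D` are two integers, moving `δ` from `D` to `C` changes the signs in opposite
directions, so that the changes partly cancel. -/
lemma abs_sign_change_le {C D δ : ℤ} (hδ : δ = 0 ∨ δ = 2 ∨ δ = -2) :
    |((C + δ).sign - C.sign) + ((D - δ).sign - D.sign)| ≤ 2 ∧
    (Even C → Even D → |((C + δ).sign - C.sign) + ((D - δ).sign - D.sign)| ≤ 1) := by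
  have key : ∀ c : ℤ, (c.sign ≤ (c + 2).sign ∧ (c + 2).sign ≤ c.sign + 2) ∧
      (Even c → (c + 2).sign ≤ c.sign + 1) := by
    intro c
    have h1 := sign_cases c
    have h2 := sign_cases (c + 2)
    exact ⟨by omega, fun ⟨t, ht⟩ => by omega⟩
  rcases hδ with rfl | rfl | rfl
  · simp
  · have h1 := key C
    have h2 := key (D - 2)
    rw [sub_add_cancel] at h2
    refine ⟨abs_le.2 (by omega), fun hC hD => abs_le.2 ?_⟩
    have := h1.2 hC
    have := h2.2 (hD.sub even_two)
    omega
  · have h1 := key (C - 2)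
    have h2 := key D
    rw [sub_add_cancel] at h1
    rw [← sub_eq_add_neg, sub_neg_eq_add]
    refine ⟨abs_le.2 (by omega), fun hC hD => abs_le.2 ?_⟩
    have := h1.2 (hC.sub even_two)
    have := h2.2 hD
    omega

/-- Exchanging two entries of one row leaves the row sums alone and changes two column sums by
opposite amounts. -/
lemma IsSigned.abs_imbalance_swap_row {x : Fin n × Fin n → ℤ} (hx : IsSigned x) {i a b : Fin n}
    (ha : i ≠ a) (hb : i ≠ b) :
    |imbalance (x ∘ Equiv.swap (i, a) (i, b)) - imbalance x| ≤ 2 ∧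
    (Odd n → |imbalance (x ∘ Equiv.swap (i, a) (i, b)) - imbalance x| ≤ 1) := by
  rcases eq_or_ne a b with rfl | hab
  · simp [Equiv.swap_self]
  set y := x ∘ Equiv.swap (i, a) (i, b) with hy
  set δ := x (i, b) - x (i, a) with hδ
  have hyx : ∀ r c, y (r, c) = x (r, c) +
      ((if r = i then (if c = a then δ else 0) else 0) -
        (if r = i then (if c = b then δ else 0) else 0)) := by
    intro r c
    simp only [hy, Function.comp_apply, Equiv.swap_apply_def, Prod.mk.injEq]
    by_cases hr : r = i
    · subst hr
      by_cases hca : c = a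
      · subst hca; simp [hab, hδ]
      · by_cases hcb : c = b
        · subst hcb; simp [hca, hδ]
        · simp [hca, hcb]
    · simp [hr]
  have hrow : rowImbalance y = rowImbalance x := by
    refine sum_congr rfl fun r _ => congrArg Int.sign ?_
    simp only [rowSum, hyx, sum_add_distrib, sum_sub_distrib]
    by_cases hr : r = i <;> simp [hr]
  have hcol : ∀ c, rowSum (y ∘ Prod.swap) c = rowSum (x ∘ Prod.swap) c +
      ((if c = a then δ else 0) - (if c = b then δ else 0)) := by
    intro c
    simp [rowSum, hyx, sum_add_distrib, sum_sub_distrib]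
  have hdiff : imbalance y - imbalance x =
      ((rowSum (x ∘ Prod.swap) a + δ).sign - (rowSum (x ∘ Prod.swap) a).sign) +
      ((rowSum (x ∘ Prod.swap) b - δ).sign - (rowSum (x ∘ Prod.swap) b).sign) := by
    rw [imbalance, imbalance, hrow, add_sub_add_left_eq_sub, rowImbalance, rowImbalance,
      ← sum_sub_distrib, ← sum_subset (subset_univ {a, b}), sum_pair hab, hcol, hcol]
    · simp [hab, hab.symm, sub_eq_add_neg]
    · intro c _ hc
      simp only [mem_insert, mem_singleton, not_or] at hc
      simp [hcol, hc.1, hc.2]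
  have hδ' : δ = 0 ∨ δ = 2 ∨ δ = -2 := by
    have := hx.offDiag i a ha
    have := hx.offDiag i b hb
    omega
  rw [hdiff]
  exact ⟨(abs_sign_change_le hδ').1, fun hn => (abs_sign_change_le hδ').2
    (hx.transpose.rowSum_even hn a) (hx.transpose.rowSum_even hn b)⟩

lemma Step.abs_imbalance_sub {x y : Fin n × Fin n → ℤ} (h : Step x y) :
    |imbalance y - imbalance x| ≤ 2 ∧ (Odd n → |imbalance y - imbalance x| ≤ 1) := by
  obtain ⟨hx, ⟨i, a⟩, ⟨j, b⟩, hp, hq, h | h, rfl⟩ := h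
  · obtain rfl : i = j := h
    exact hx.abs_imbalance_swap_row hp hq
  · obtain rfl : a = b := h
    have := hx.transpose.abs_imbalance_swap_row hp.symm hq.symm
    rw [imbalance_transpose] at this
    have hc : (x ∘ Prod.swap) ∘ Equiv.swap (a, i) (a, j) =
        (x ∘ Equiv.swap (i, a) (j, a)) ∘ Prod.swap := by
      ext ⟨r, c⟩
      simp [Equiv.swap_apply_def, apply_ite Prod.swap, and_comm]
    rwa [show (x ∘ Prod.swap) ∘ Equiv.swap ((i, a).2, (i, a).1) ((i, a).2, (j, a).1) =
      _ from hc, imbalance_transpose] at this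

/-! ### Connecting balanced matrices by swaps -/

/-- `p` and `q` are linked if their entries can be exchanged in every signed matrix by a chain of
swaps inside rows and columns. -/
def Linked (p q : Fin n × Fin n) : Prop :=
  ∀ x : Fin n × Fin n → ℤ, IsSigned x → Relation.ReflTransGen Step x (x ∘ Equiv.swap p q)

lemma linked_of_adjacent {p q : Fin n × Fin n} (hp : p.1 ≠ p.2) (hq : q.1 ≠ q.2)
    (h : p.1 = q.1 ∨ p.2 = q.2) : Linked p q :=
  fun _ hx => .single ⟨hx, p, q, hp, hq, h, rfl⟩

lemma Linked.trans {p q r : Fin n × Fin n} (h₁ : Linked p q) (h₂ : Linked q r) : Linked p r := by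
  intro x hx
  by_cases hqp : q = p
  · rw [← hqp]; exact h₂ x hx
  by_cases hpr : p = r
  · rw [← hpr, Equiv.swap_self]; exact .refl
  by_cases hqr : q = r
  · rw [← hqr]; exact h₁ x hx
  have e₁ := h₁ x hx
  have e₂ := h₂ _ (isSigned_and_sum_eq_of_reach hx e₁).1
  have e₃ := h₁ _ (isSigned_and_sum_eq_of_reach hx (e₁.trans e₂)).1
  -- `(p r)` is the conjugate of `(q r)` by `(p q)`
  have key : Equiv.swap p q * Equiv.swap q r * Equiv.swap p q = Equiv.swap p r := by
    rw [Equiv.swap_comm q r, Equiv.swap_comm p r, Equiv.swap_comm p q]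
    rw [Equiv.swap_mul_swap_mul_swap (Ne.symm hqr) (Ne.symm hpr), Equiv.swap_comm]
  rw [← key]
  exact (e₁.trans e₂).trans e₃

/-- Edges of the crown graph on at least six vertices are linked: the third index is needed to
pass from `(i, j)` to `(j, i)`. -/
lemma linked_of_ne (hn : 3 ≤ n) {p q : Fin n × Fin n} (hp : p.1 ≠ p.2) (hq : q.1 ≠ q.2) :
    Linked p q := by
  obtain ⟨i, j⟩ := p
  obtain ⟨k, l⟩ := q
  dsimp only at hp hq
  by_cases hil : i = l
  · by_cases hkj : k = j
    · subst hil hkj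
      obtain ⟨c, hc⟩ : ∃ c, c ∉ ({i, k} : Finset (Fin n)) := by
        by_contra! h
        have h1 : #(univ : Finset (Fin n)) ≤ #{i, k} := card_le_card fun c _ => h c
        have h2 : #{i, k} ≤ 2 := card_le_two
        rw [card_univ, Fintype.card_fin] at h1
        omega
      simp only [mem_insert, mem_singleton, not_or] at hc
      exact ((linked_of_adjacent (p := (i, k)) (q := (i, c)) hp (Ne.symm hc.1) (.inl rfl)).trans
        (linked_of_adjacent (q := (k, c)) (Ne.symm hc.1) (Ne.symm hc.2) (.inr rfl))).trans
        (linked_of_adjacent (Ne.symm hc.2) (q := (k, i)) hq (.inl rfl))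
    · exact (linked_of_adjacent (p := (i, j)) (q := (k, j)) hp hkj (.inr rfl)).trans
        (linked_of_adjacent (q := (k, l)) hkj hq (.inl rfl))
  · exact (linked_of_adjacent (p := (i, j)) (q := (i, l)) hp hil (.inl rfl)).trans
      (linked_of_adjacent (q := (k, l)) hil hq (.inr rfl))

/-- Any two signed matrices with the same total are connected by steps: exchanging an entry which
is too large with one which is too small reduces the number of disagreements. -/
theorem reach_of_sum_eq (hn : 3 ≤ n) {x y : Fin n × Fin n → ℤ} (hx : IsSigned x)
    (hy : IsSigned y) (hs : ∑ p, x p = ∑ p, y p) : Relation.ReflTransGen Step x y := by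
  induction hd : #{p | x p ≠ y p} using Nat.strong_induction_on generalizing x with
  | _ d ih =>
    by_cases hxy : x = y
    · rw [hxy]
    obtain ⟨r, hr⟩ := Function.ne_iff.1 hxy
    have h0 : ∑ p, (x p - y p) = 0 := by rw [sum_sub_distrib, hs, sub_self]
    obtain ⟨p, -, hp⟩ := exists_pos_of_sum_zero_of_exists_nonzero _ h0
      ⟨r, mem_univ r, sub_ne_zero.2 hr⟩
    have h0' : ∑ p, (y p - x p) = 0 := by rw [sum_sub_distrib, hs, sub_self]
    obtain ⟨q, -, hq⟩ := exists_pos_of_sum_zero_of_exists_nonzero _ h0'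
      ⟨r, mem_univ r, sub_ne_zero.2 hr.symm⟩
    have hoff : ∀ r : Fin n × Fin n, x r ≠ y r → r.1 ≠ r.2 := by
      rintro ⟨i, j⟩ h (e : i = j)
      rw [e] at h
      exact h ((hx.diag j).trans (hy.diag j).symm)
    have hp1 : p.1 ≠ p.2 := hoff p (by omega)
    have hq1 : q.1 ≠ q.2 := hoff q (by omega)
    have hxp := hx.offDiag _ _ hp1
    have hyp := hy.offDiag _ _ hp1
    have hxq := hx.offDiag _ _ hq1
    have hyq := hy.offDiag _ _ hq1
    refine (linked_of_ne hn hp1 hq1 x hx).trans (ih _ ?_ (hx.comp_swap hp1 hq1)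
      ((Equiv.sum_comp (Equiv.swap p q) x).trans hs) rfl)
    rw [← hd]
    refine card_lt_card (ssubset_iff_of_subset ?_ |>.2 ⟨p, by simp; omega, ?_⟩)
    · intro s
      simp only [mem_filter, mem_univ, true_and, Function.comp_apply]
      intro h
      by_cases h1 : s = p
      · rw [h1]; omega
      by_cases h2 : s = q
      · rw [h2]; omega
      rwa [Equiv.swap_apply_of_ne_of_ne h1 h2] at h
    · simp only [mem_filter, mem_univ, true_and, Function.comp_apply, Equiv.swap_apply_left]
      simp only [Prod.mk.eta] at *
      omega

/-- Discrete intermediate value theorem along a chain. -/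
lemma exists_reach_eq {α : Type*} {r : α → α → Prop} {ψ : α → ℤ}
    (hψ : ∀ a b, r a b → |ψ b - ψ a| ≤ 1) {x y : α} (h : Relation.ReflTransGen r x y) {k : ℤ}
    (h₁ : ψ y ≤ k) (h₂ : k ≤ ψ x) : ∃ z, Relation.ReflTransGen r x z ∧ ψ z = k := by
  induction h with
  | refl => exact ⟨x, .refl, le_antisymm h₁ h₂⟩
  | @tail b c hb hbc ih =>
    have := abs_le.1 (hψ _ _ hbc)
    rcases le_or_gt (ψ b) k with h | h
    · exact ih h
    · exact ⟨c, hb.tail hbc, by omega⟩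

/-- For odd `n`, a chain from `x` to its complement `-x` passes through every value of the
imbalance between `0` and that of `x`. -/
theorem exists_imbalance_eq_of_odd (hn : 3 ≤ n) (ho : Odd n) {x : Fin n × Fin n → ℤ}
    (hx : IsSigned x) (hs : ∑ p, x p = 0) {k : ℤ} (h₀ : 0 ≤ k) (h₁ : k ≤ imbalance x) :
    ∃ z : Fin n × Fin n → ℤ, IsSigned z ∧ ∑ p, z p = 0 ∧ imbalance z = k := by
  have hr := reach_of_sum_eq hn hx hx.neg (by simp [hs])
  obtain ⟨z, hz, hk⟩ := exists_reach_eq (ψ := imbalance) (fun a b h => h.abs_imbalance_sub.2 ho) hr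
    (by rw [imbalance_neg]; omega) h₁
  have := isSigned_and_sum_eq_of_reach hx hz
  exact ⟨z, this.1, this.2.trans hs, hk⟩

lemma IsSigned.rowImbalance_even {x : Fin n × Fin n → ℤ} (hx : IsSigned x) (hn : Even n) :
    Even (rowImbalance x) := by
  have h : ∀ i, ∃ t, (rowSum x i).sign = 2 * t + 1 := fun i => by
    obtain ⟨t, ht⟩ := hx.rowSum_odd hn i
    rcases Int.sign_trichotomy (rowSum x i) with h | h | h
    · exact ⟨0, by omega⟩
    · rw [Int.sign_eq_zero_iff_zero] at h; omega
    · exact ⟨-1, by omega⟩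
  choose t ht using h
  obtain ⟨m, hm⟩ := hn
  refine ⟨∑ i, t i + m, ?_⟩
  simp_rw [rowImbalance, ht, sum_add_distrib, ← mul_sum]
  simp only [sum_const, card_univ, Fintype.card_fin, hm]
  ring

lemma IsSigned.imbalance_even {x : Fin n × Fin n → ℤ} (hx : IsSigned x) (hn : Even n) :
    Even (imbalance x) :=
  (hx.rowImbalance_even hn).add (hx.transpose.rowImbalance_even hn)

/-- For even `n` the imbalance is even, and a step moves it by at most `2`; so a chain from `x` to
`-x` passes through every even value between `0` and the imbalance of `x`. -/
theorem exists_imbalance_eq_of_even (hn : 3 ≤ n) (he : Even n) {x : Fin n × Fin n → ℤ}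
    (hx : IsSigned x) (hs : ∑ p, x p = 0) {k : ℤ} (h₀ : 0 ≤ k) (h₁ : k ≤ imbalance x)
    (hk : Even k) :
    ∃ z : Fin n × Fin n → ℤ, IsSigned z ∧ ∑ p, z p = 0 ∧ imbalance z = k := by
  have hr := reach_of_sum_eq hn hx hx.neg (by simp [hs])
  obtain ⟨l, rfl⟩ := hk
  obtain ⟨z, hz, hk⟩ := exists_reach_eq (ψ := fun y => imbalance y / 2) (k := l)
    (fun a b h => by
      have h2 := abs_le.1 h.abs_imbalance_sub.1
      obtain ⟨s, hs⟩ := h.1.imbalance_even he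
      obtain ⟨t, ht⟩ := h.isSigned.imbalance_even he
      rw [abs_le]
      omega) hr
    (by rw [imbalance_neg]; omega) (by omega)
  have := isSigned_and_sum_eq_of_reach hx hz
  obtain ⟨s, hs'⟩ := this.1.imbalance_even he
  exact ⟨z, this.1, this.2.trans hs, by omega⟩

/-! ### Balanced matrices of maximal imbalance -/

/-- The signed matrix whose entries `1` are the off-diagonal positions satisfying `A`. -/
def signedMatrix (A : ℕ → ℕ → Prop) [DecidableRel A] (p : Fin n × Fin n) : ℤ :=
  if p.1 = p.2 then 0 else if A p.1 p.2 then 1 else -1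

lemma isSigned_signedMatrix (A : ℕ → ℕ → Prop) [DecidableRel A] :
    IsSigned (signedMatrix A : Fin n × Fin n → ℤ) := by
  refine ⟨fun i => by simp [signedMatrix], fun i j h => ?_⟩
  by_cases hA : A i j <;> simp [signedMatrix, h, hA]

lemma signedMatrix_transpose (A : ℕ → ℕ → Prop) [DecidableRel A] :
    (signedMatrix A : Fin n × Fin n → ℤ) ∘ Prod.swap = signedMatrix (fun i j => A j i) := by
  ext ⟨i, j⟩
  simp [signedMatrix, eq_comm]

lemma rowSum_signedMatrix (A : ℕ → ℕ → Prop) [DecidableRel A] (i : Fin n) (hA : ¬ A i i) :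
    rowSum (signedMatrix A) i = 2 * #{j : Fin n | A i j} - (n - 1) := by
  rw [(isSigned_signedMatrix A).rowSum_eq_two_mul]
  congr 4
  ext j
  by_cases hij : i = j
  · subst hij; simp [signedMatrix, hA]
  · by_cases h : A i j <;> simp [signedMatrix, hij, h]

/-- The positions `(i, j)` in the leading `N × N` block for which `j - i` is congruent modulo `N`
to one of `1, …, m`; for `m < N` this is a circulant pattern off the diagonal. -/
def Circulant (N m i j : ℕ) : Prop := (i < j ∧ j ≤ i + m ∧ j < N) ∨ (i < N ∧ j + N ≤ i + m)

instance (N m : ℕ) : DecidableRel (Circulant N m) := fun _ _ =>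
  inferInstanceAs (Decidable (_ ∨ _))

lemma card_circulant_row {N m : ℕ} (hm : m < N) (hN : N ≤ n) {i : ℕ} (hi : i < N) :
    #{j : Fin n | Circulant N m i j} = m := by
  refine Eq.trans (b := #(Icc 1 m)) (card_bij' (fun j _ => if i < j then (j : ℕ) - i else j + N - i)
    (fun k hk => ⟨if i + k < N then i + k else i + k - N, ?_⟩) ?_ ?_ ?_ ?_) (by simp)
  · rw [mem_Icc] at hk
    split_ifs <;> omega
  · intro j hj
    rw [mem_filter_univ, Circulant] at hj
    rw [mem_Icc]
    split_ifs <;> omega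
  · intro k hk
    rw [mem_Icc] at hk
    rw [mem_filter_univ, Circulant]
    dsimp only
    split_ifs <;> omega
  · intro j hj
    rw [mem_filter_univ, Circulant] at hj
    ext
    dsimp only
    split_ifs <;> omega
  · intro k hk
    rw [mem_Icc] at hk
    dsimp only
    split_ifs <;> omega

lemma card_circulant_col {N m : ℕ} (hm : m < N) (hN : N ≤ n) {j : ℕ} (hj : j < N) :
    #{i : Fin n | Circulant N m i j} = m := by
  refine Eq.trans (b := #(Icc 1 m)) (card_bij' (fun i _ => if i < j then j - (i : ℕ) else j + N - i)
    (fun k hk => ⟨if k ≤ j then j - k else j + N - k, ?_⟩) ?_ ?_ ?_ ?_) (by simp)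
  · rw [mem_Icc] at hk
    split_ifs <;> omega
  · intro i hi
    rw [mem_filter_univ, Circulant] at hi
    rw [mem_Icc]
    split_ifs <;> omega
  · intro k hk
    rw [mem_Icc] at hk
    rw [mem_filter_univ, Circulant]
    dsimp only
    split_ifs <;> omega
  · intro i hi
    rw [mem_filter_univ, Circulant] at hi
    ext
    dsimp only
    split_ifs <;> omega
  · intro k hk
    rw [mem_Icc] at hk
    dsimp only
    split_ifs <;> omega

lemma sum_fin_eq {N r : ℕ} (g : Fin (N + r) → ℤ) (c : ℤ) (hg : ∀ i : Fin (N + r), i < N → g i = c) :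
    ∑ i, g i = N * c + ∑ i : Fin r, g (Fin.natAdd N i) := by
  rw [Fin.sum_univ_add]
  congr 1
  rw [sum_congr rfl fun i _ => hg (Fin.castAdd r i) (by simp)]
  simp

/-- For `n = 2 l + 2`, the circulant with `l + 1` entries in each of the first `n - 1` rows and
columns has row and column sums `1, …, 1, -(n - 1)`. -/
lemma exists_extremal_of_even (hn : Even n) (h4 : 2 < n) :
    ∃ x : Fin n × Fin n → ℤ, IsSigned x ∧ ∑ p, x p = 0 ∧ imbalance x = 2 * n - 4 := by
  obtain ⟨l, rfl⟩ : ∃ l, n = 2 * l + 1 + 1 := by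
    obtain ⟨m, rfl⟩ := hn
    exact ⟨m - 1, by omega⟩
  set A := Circulant (2 * l + 1) (l + 1)
  have hrow : ∀ i : Fin (2 * l + 1 + 1), i < 2 * l + 1 → rowSum (signedMatrix A) i = 1 := by
    intro i hi
    rw [rowSum_signedMatrix _ _ (by simp only [A, Circulant]; omega),
      card_circulant_row (by omega) (by omega) hi]
    push_cast; ring
  have hcol : ∀ i : Fin (2 * l + 1 + 1), i < 2 * l + 1 →
      rowSum (signedMatrix fun i j => A j i) i = 1 := by
    intro i hi
    rw [rowSum_signedMatrix _ _ (by simp only [A, Circulant]; omega),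
      card_circulant_col (by omega) (by omega) hi]
    push_cast; ring
  have hrow' : rowSum (signedMatrix A) (Fin.natAdd (2 * l + 1) (0 : Fin 1)) = -(2 * l + 1) := by
    rw [rowSum_signedMatrix _ _ (by simp [A, Circulant]),
      filter_false_of_mem fun j _ => by simp [A, Circulant]; omega]
    push_cast [card_empty]; ring
  have hcol' : rowSum (signedMatrix fun i j => A j i) (Fin.natAdd (2 * l + 1) (0 : Fin 1)) =
      -(2 * l + 1) := by
    rw [rowSum_signedMatrix _ _ (by simp [A, Circulant]),
      filter_false_of_mem fun j _ => by simp [A, Circulant]; omega]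
    push_cast [card_empty]; ring
  refine ⟨signedMatrix A, isSigned_signedMatrix A, ?_, ?_⟩
  · rw [← sum_rowSum, sum_fin_eq _ 1 hrow, Fin.sum_univ_one, hrow']
    push_cast; ring
  · rw [imbalance, signedMatrix_transpose, rowImbalance, rowImbalance,
      sum_fin_eq _ 1 (fun i hi => by rw [hrow i hi]; rfl),
      sum_fin_eq _ 1 (fun i hi => by rw [hcol i hi]; rfl),
      Fin.sum_univ_one, Fin.sum_univ_one, hrow', hcol', Int.sign_eq_neg_one_of_neg (by omega)]
    push_cast; ring

/-- For `n = 2 l + 3` with `l ≥ 2`, take the circulant with `l + 2` entries in each of the first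
`n - 2` rows and columns, and the additional position `(n - 2, n - 1)` needed for balance: the row
and column sums are `2, …, 2` and two negative numbers. For `n = 5` there is no room for three
entries per row in a `3 × 3` block off the diagonal, and the matrix is given explicitly. -/
lemma exists_extremal_of_odd (hn : Odd n) (h5 : 3 < n) :
    ∃ x : Fin n × Fin n → ℤ, IsSigned x ∧ ∑ p, x p = 0 ∧ imbalance x = 2 * n - 8 := by
  obtain ⟨l, rfl⟩ : ∃ l, n = 2 * l + 1 + 2 := by
    obtain ⟨m, rfl⟩ := hn
    exact ⟨m - 1, by omega⟩
  rcases Nat.lt_or_ge l 2 with hl | hl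
  · obtain rfl : l = 1 := by omega
    refine ⟨fun p => !![0, -1, 1, 1, 1; -1, 0, 1, 1, 1; 1, -1, 0, 1, 1; -1, -1, 1, 0, -1;
      -1, -1, -1, -1, 0] p.1 p.2, ⟨by decide, by decide⟩, by decide, by decide⟩
  set A : ℕ → ℕ → Prop := fun i j =>
    Circulant (2 * l + 1) (l + 2) i j ∨ (i = 2 * l + 1 ∧ j = 2 * l + 2)
  have hrow : ∀ i : Fin (2 * l + 1 + 2), i < 2 * l + 1 → rowSum (signedMatrix A) i = 2 := by
    intro i hi
    rw [rowSum_signedMatrix _ _ (by simp only [A, Circulant]; omega),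
      filter_congr (q := fun j : Fin (2 * l + 1 + 2) => Circulant (2 * l + 1) (l + 2) i j)
        fun j _ => by simp only [A, Circulant]; omega,
      card_circulant_row (by omega) (by omega) hi]
    push_cast; ring
  have hcol : ∀ i : Fin (2 * l + 1 + 2), i < 2 * l + 1 →
      rowSum (signedMatrix fun i j => A j i) i = 2 := by
    intro i hi
    rw [rowSum_signedMatrix _ _ (by simp only [A, Circulant]; omega),
      filter_congr (q := fun j : Fin (2 * l + 1 + 2) => Circulant (2 * l + 1) (l + 2) j i)
        fun j _ => by simp only [A, Circulant]; omega,
      card_circulant_col (by omega) (by omega) hi]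
    push_cast; ring
  have hlow : ∀ (B : ℕ → ℕ → Prop) [DecidableRel B] (i : Fin (2 * l + 1 + 2)), ¬ B i i →
      (∀ j, ¬ B i j) → rowSum (signedMatrix B) i = -(2 * l + 2) := by
    intro B _ i hi hB
    rw [rowSum_signedMatrix _ _ hi,
      filter_false_of_mem (p := fun j : Fin (2 * l + 1 + 2) => B i j) fun j _ => hB j]
    push_cast [card_empty]; ring
  have hone : ∀ (B : ℕ → ℕ → Prop) [DecidableRel B] (i k : Fin (2 * l + 1 + 2)), ¬ B i i →
      (∀ j : Fin (2 * l + 1 + 2), B i j ↔ j = k) → rowSum (signedMatrix B) i = -(2 * l) := by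
    intro B _ i k hi hB
    rw [rowSum_signedMatrix _ _ hi, filter_congr fun j _ => hB j, filter_eq', if_pos (mem_univ k),
      card_singleton]
    push_cast; ring
  have hrow₀ : rowSum (signedMatrix A) (Fin.natAdd (2 * l + 1) (0 : Fin 2)) = -(2 * l) :=
    hone _ _ (Fin.natAdd (2 * l + 1) (1 : Fin 2)) (by simp [A, Circulant]) fun j => by
      simp [A, Circulant, Fin.ext_iff]; omega
  have hrow₁ : rowSum (signedMatrix A) (Fin.natAdd (2 * l + 1) (1 : Fin 2)) = -(2 * l + 2) :=
    hlow _ _ (by simp [A, Circulant]) fun j => by simp [A, Circulant]; omega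
  have hcol₀ : rowSum (signedMatrix fun i j => A j i) (Fin.natAdd (2 * l + 1) (0 : Fin 2)) =
      -(2 * l + 2) :=
    hlow _ _ (by simp [A, Circulant]) fun j => by simp [A, Circulant]; omega
  have hcol₁ : rowSum (signedMatrix fun i j => A j i) (Fin.natAdd (2 * l + 1) (1 : Fin 2)) =
      -(2 * l) :=
    hone _ _ (Fin.natAdd (2 * l + 1) (0 : Fin 2)) (by simp [A, Circulant]) fun j => by
      simp [A, Circulant, Fin.ext_iff]; omega
  refine ⟨signedMatrix A, isSigned_signedMatrix A, ?_, ?_⟩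
  · rw [← sum_rowSum, sum_fin_eq _ 2 hrow, Fin.sum_univ_two, hrow₀, hrow₁]
    push_cast; ring
  · rw [imbalance, signedMatrix_transpose, rowImbalance, rowImbalance,
      sum_fin_eq _ 1 (fun i hi => by rw [hrow i hi]; rfl),
      sum_fin_eq _ 1 (fun i hi => by rw [hcol i hi]; rfl),
      Fin.sum_univ_two, Fin.sum_univ_two, hrow₀, hrow₁, hcol₀, hcol₁,
      Int.sign_eq_neg_one_of_neg (a := -(2 * l : ℤ)) (by omega),
      Int.sign_eq_neg_one_of_neg (by omega)]
    push_cast; ring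

/-! ### Labelings of the crown graph as signed matrices -/

/-- The crown graph `K_n × K_2`. -/
abbrev crown (n : ℕ) : SimpleGraph (Fin n × Fin 2) :=
  (completeGraph (Fin n)).directProd (completeGraph (Fin 2))

lemma crown_adj {i j : Fin n} {a b : Fin 2} : (crown n).Adj (i, a) (j, b) ↔ i ≠ j ∧ a ≠ b := by
  simp [directProd]

/-- The edge of the crown graph joining `(i, 0)` to `(j, 1)`. -/
def edge {i j : Fin n} (h : i ≠ j) : (crown n).edgeSet :=
  ⟨s((i, 0), (j, 1)), (crown n).mem_edgeSet.2 (crown_adj.2 ⟨h, by decide⟩)⟩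

lemma edge_inj {i j k l : Fin n} {h : i ≠ j} {h' : k ≠ l} :
    edge h = edge h' ↔ i = k ∧ j = l := by
  simp [edge]

lemma exists_eq_edge (e : (crown n).edgeSet) : ∃ (i j : Fin n) (h : i ≠ j), e = edge h := by
  obtain ⟨e, he⟩ := e
  induction e with
  | _ u v =>
    obtain ⟨i, a⟩ := u
    obtain ⟨j, b⟩ := v
    have h := crown_adj.1 ((crown n).mem_edgeSet.1 he)
    fin_cases a <;> fin_cases b
    · exact absurd rfl h.2
    · exact ⟨i, j, h.1, rfl⟩
    · exact ⟨j, i, h.1.symm, Subtype.ext Sym2.eq_swap⟩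
    · exact absurd rfl h.2

/-- The matrix entry `1` or `-1` standing for the label `1` or `0`. -/
def labelSign (c : ZMod 2) : ℤ := if c = 1 then 1 else -1

lemma labelSign_inj : ∀ {c d : ZMod 2}, labelSign c = labelSign d ↔ c = d := by decide

lemma labelSign_ne_zero : ∀ c : ZMod 2, labelSign c ≠ 0 := by decide

/-- The signed matrix of a labeling of the crown graph. -/
def toMatrix (f : (crown n).BinaryEdgeLabeling) (p : Fin n × Fin n) : ℤ :=
  if h : p.1 ≠ p.2 then labelSign (f (edge h)) else 0

lemma toMatrix_eq_labelSign {f : (crown n).BinaryEdgeLabeling} {i j : Fin n} {c : ZMod 2} :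
    toMatrix f (i, j) = labelSign c ↔ ∃ h : i ≠ j, f (edge h) = c := by
  by_cases h : i = j
  · simp [toMatrix, h, (labelSign_ne_zero c).symm]
  · simp [toMatrix, h, labelSign_inj]

lemma isSigned_toMatrix (f : (crown n).BinaryEdgeLabeling) : IsSigned (toMatrix f) := by
  refine ⟨fun i => by simp [toMatrix], fun i j h => ?_⟩
  simp only [toMatrix, ne_eq, h, not_false_eq_true, dite_true, labelSign]
  split_ifs <;> simp

lemma exists_toMatrix_eq {x : Fin n × Fin n → ℤ} (hx : IsSigned x) :
    ∃ f : (crown n).BinaryEdgeLabeling, toMatrix f = x := by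
  classical
  refine ⟨fun e => if ∃ (i j : Fin n) (h : i ≠ j), e = edge h ∧ x (i, j) = 1 then 1 else 0, ?_⟩
  ext ⟨i, j⟩
  by_cases h : i = j
  · subst h; simp [toMatrix, hx.diag]
  · have : (∃ (k l : Fin n) (h' : k ≠ l), edge h = edge h' ∧ x (k, l) = 1) ↔ x (i, j) = 1 := by
      constructor
      · rintro ⟨k, l, h', he, hkl⟩
        obtain ⟨rfl, rfl⟩ := edge_inj.1 he
        exact hkl
      · exact fun hij => ⟨i, j, h, rfl, hij⟩
    simp only [toMatrix, ne_eq, h, not_false_eq_true, dite_true, this]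
    rcases hx.offDiag i j h with h1 | h1 <;> simp [h1, labelSign]

lemma edgeCount_eq (f : (crown n).BinaryEdgeLabeling) (c : ZMod 2) :
    f.edgeCount c = #{p | toMatrix f p = labelSign c} := by
  rw [BinaryEdgeLabeling.edgeCount, ← Set.ncard_coe_finset]
  symm
  refine Set.ncard_congr (fun p hp => edge (toMatrix_eq_labelSign.1 (mem_filter.1 hp).2).1) ?_ ?_ ?_
  · intro p hp
    exact (toMatrix_eq_labelSign.1 (mem_filter.1 hp).2).2
  · intro p q hp hq h
    exact Prod.ext (edge_inj.1 h).1 (edge_inj.1 h).2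
  · intro e he
    obtain ⟨i, j, h, rfl⟩ := exists_eq_edge e
    exact ⟨(i, j), by simpa using toMatrix_eq_labelSign.2 ⟨h, he⟩, rfl⟩

/-- The number of edges labeled `0` or `1` is even, so that edge-friendliness means exact
balance. -/
lemma isEdgeFriendly_iff (f : (crown n).BinaryEdgeLabeling) :
    f.IsEdgeFriendly ↔ ∑ p, toMatrix f p = 0 := by
  have h := sum_eq_card_sub_card (toMatrix f) (isSigned_toMatrix f).values
  obtain ⟨t, ht⟩ := (isSigned_toMatrix f).sum_even
  have h0 : f.edgeCount 0 = #{p | toMatrix f p = -1} := edgeCount_eq f 0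
  have h1 : f.edgeCount 1 = #{p | toMatrix f p = 1} := edgeCount_eq f 1
  rw [BinaryEdgeLabeling.IsEdgeFriendly, abs_le]
  omega

lemma labelDegree_row (f : (crown n).BinaryEdgeLabeling) (c : ZMod 2) (i : Fin n) :
    f.labelDegree c (i, 0) = #{j | toMatrix f (i, j) = labelSign c} := by
  rw [BinaryEdgeLabeling.labelDegree, ← Set.ncard_coe_finset,
    ← Set.ncard_image_of_injective _ (Prod.mk_left_injective (α := Fin n) (1 : Fin 2))]
  refine congrArg Set.ncard (Set.ext ?_)
  rintro ⟨j, b⟩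
  simp only [BinaryEdgeLabeling.labelNeighborSet, Set.mem_ofPred_eq, coe_filter, mem_univ, true_and,
    Set.mem_image, toMatrix_eq_labelSign, Prod.mk.injEq]
  constructor
  · rintro ⟨h, hf⟩
    have h' := crown_adj.1 h
    obtain rfl : b = 1 := by omega
    exact ⟨j, ⟨h'.1, hf⟩, rfl, rfl⟩
  · rintro ⟨_, ⟨h, hf⟩, rfl, rfl⟩
    exact ⟨crown_adj.2 ⟨h, by decide⟩, hf⟩

lemma labelDegree_col (f : (crown n).BinaryEdgeLabeling) (c : ZMod 2) (j : Fin n) :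
    f.labelDegree c (j, 1) = #{i | (toMatrix f ∘ Prod.swap) (j, i) = labelSign c} := by
  rw [BinaryEdgeLabeling.labelDegree, ← Set.ncard_coe_finset,
    ← Set.ncard_image_of_injective _ (Prod.mk_left_injective (α := Fin n) (0 : Fin 2))]
  refine congrArg Set.ncard (Set.ext ?_)
  rintro ⟨i, b⟩
  simp only [BinaryEdgeLabeling.labelNeighborSet, Set.mem_ofPred_eq, coe_filter, mem_univ, true_and,
    Set.mem_image, Function.comp_apply, Prod.swap_prod_mk, toMatrix_eq_labelSign, Prod.mk.injEq]
  have key : ∀ (h : i ≠ j) (h' : (crown n).Adj (j, 1) (i, 0)),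
      (⟨s((j, 1), (i, 0)), (crown n).mem_edgeSet.2 h'⟩ : (crown n).edgeSet) = edge h :=
    fun _ _ => Subtype.ext Sym2.eq_swap
  constructor
  · rintro ⟨h, hf⟩
    have h' := crown_adj.1 h
    obtain rfl : b = 0 := by omega
    rw [key h'.1.symm h] at hf
    exact ⟨i, ⟨h'.1.symm, hf⟩, rfl, rfl⟩
  · rintro ⟨i, ⟨h, hf⟩, rfl, rfl⟩
    have h' : (crown n).Adj (j, 1) (i, 0) := crown_adj.2 ⟨Ne.symm h, by decide⟩
    exact ⟨h', by rw [key h h', hf]⟩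

lemma vertexCount_sub {V : Type*} [Fintype V] {G : SimpleGraph V} (f : G.BinaryEdgeLabeling) :
    (f.vertexCount 1 : ℤ) - f.vertexCount 0 =
      ∑ v, ((f.labelDegree 1 v : ℤ) - f.labelDegree 0 v).sign := by
  classical
  have hc : ∀ c, f.vertexCount c = #{v | f.vertexLabel v = some c} := fun c => by
    rw [BinaryEdgeLabeling.vertexCount, ← Set.ncard_coe_finset]; simp
  rw [hc, hc, natCast_card_filter, natCast_card_filter, ← sum_sub_distrib]
  refine sum_congr rfl fun v _ => ?_
  rw [BinaryEdgeLabeling.vertexLabel]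
  rcases lt_trichotomy (f.labelDegree 1 v) (f.labelDegree 0 v) with h | h | h
  · rw [Int.sign_eq_neg_one_of_neg (by omega)]
    simp [h]
  · simp [h]
  · rw [Int.sign_eq_one_of_pos (by omega)]
    simp [h, h.not_gt]

lemma vertexCount_sub_eq_imbalance (f : (crown n).BinaryEdgeLabeling) :
    (f.vertexCount 1 : ℤ) - f.vertexCount 0 = imbalance (toMatrix f) := by
  rw [vertexCount_sub, Fintype.sum_prod_type]
  simp only [Fin.sum_univ_two, sum_add_distrib, labelDegree_row, labelDegree_col]
  have hx := isSigned_toMatrix f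
  rw [imbalance, rowImbalance, rowImbalance]
  simp only [hx.rowSum_eq, hx.transpose.rowSum_eq]
  rfl

theorem edgeBalancedIndexSet_crown (n : ℕ) :
    (crown n).edgeBalancedIndexSet =
      {k | ∃ x : Fin n × Fin n → ℤ, IsSigned x ∧ ∑ p, x p = 0 ∧ k = |imbalance x|} := by
  ext k
  constructor
  · rintro ⟨f, hf, rfl⟩
    exact ⟨toMatrix f, isSigned_toMatrix f, (isEdgeFriendly_iff f).1 hf, by
      rw [abs_sub_comm, vertexCount_sub_eq_imbalance]⟩
  · rintro ⟨x, hx, hs, rfl⟩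
    obtain ⟨f, rfl⟩ := exists_toMatrix_eq hx
    exact ⟨f, (isEdgeFriendly_iff f).2 hs, by
      rw [abs_sub_comm, vertexCount_sub_eq_imbalance]⟩

/-- A bound on the row imbalance of all balanced matrices bounds the absolute value of the
imbalance, since it applies to the transpose and to the negative. -/
lemma abs_imbalance_le {b : ℤ}
    (hb : ∀ x : Fin n × Fin n → ℤ, IsSigned x → ∑ p, x p = 0 → rowImbalance x ≤ b)
    {x : Fin n × Fin n → ℤ} (hx : IsSigned x) (hs : ∑ p, x p = 0) :
    |imbalance x| ≤ 2 * b := by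
  have hneg : ∀ y : Fin n × Fin n → ℤ, IsSigned y → ∑ p, y p = 0 → -rowImbalance y ≤ b :=
    fun y hy hs => rowImbalance_neg y ▸ hb (-y) hy.neg (by simp [hs])
  have hs' := (sum_transpose x).trans hs
  have h1 := hb x hx hs
  have h2 := hb _ hx.transpose hs'
  have h3 := hneg x hx hs
  have h4 := hneg _ hx.transpose hs'
  rw [imbalance, abs_le]
  omega

end CrownGraph

theorem mainTheorem1 :
    (∀ n : ℕ, 0 < n → Even n →
      ((SimpleGraph.completeGraph (Fin n)).directProd (SimpleGraph.completeGraph (Fin 2))).edgeBalancedIndexSet =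
        {k : ℤ | Even k ∧ 0 ≤ k ∧ k ≤ 2 * (n : ℤ) - 4}) ∧
    (∀ n : ℕ, 3 < n → Odd n →
      ((SimpleGraph.completeGraph (Fin n)).directProd (SimpleGraph.completeGraph (Fin 2))).edgeBalancedIndexSet =
        {k : ℤ | 0 ≤ k ∧ k ≤ 2 * (n : ℤ) - 8}) := by
  refine ⟨fun n h0 he => ?_, fun n h3 ho => ?_⟩
  · rw [CrownGraph.edgeBalancedIndexSet_crown]
    ext k
    constructor
    · rintro ⟨x, hx, hs, rfl⟩
      refine ⟨even_abs.2 (hx.imbalance_even he), abs_nonneg _, ?_⟩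
      have := CrownGraph.abs_imbalance_le (b := n - 2)
        (fun x hx hs => hx.rowImbalance_le_of_even he h0 hs) hx hs
      omega
    · rintro ⟨hk, hk0, hk1⟩
      rcases Nat.lt_or_ge 2 n with h2 | h2
      · obtain ⟨x, hx, hs, hi⟩ := CrownGraph.exists_extremal_of_even he h2
        obtain ⟨z, hz, hzs, rfl⟩ := CrownGraph.exists_imbalance_eq_of_even h2 he hx hs hk0
          (hk1.trans_eq hi.symm) hk
        exact ⟨z, hz, hzs, (abs_of_nonneg hk0).symm⟩
      · -- the two edges of `K₂ × K₂` get different labels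
        obtain rfl : n = 2 := by obtain ⟨m, rfl⟩ := he; omega
        obtain rfl : k = 0 := by push_cast at hk1; omega
        exact ⟨fun p => !![0, 1; -1, 0] p.1 p.2, ⟨by decide, by decide⟩, by decide, by decide⟩
  · rw [CrownGraph.edgeBalancedIndexSet_crown]
    ext k
    constructor
    · rintro ⟨x, hx, hs, rfl⟩
      refine ⟨abs_nonneg _, ?_⟩
      have := CrownGraph.abs_imbalance_le (b := n - 4)
        (fun x hx hs => hx.rowImbalance_le_of_odd ho h3 hs) hx hs
      omega
    · rintro ⟨hk0, hk1⟩
      obtain ⟨x, hx, hs, hi⟩ := CrownGraph.exists_extremal_of_odd ho h3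
      obtain ⟨z, hz, hzs, rfl⟩ := CrownGraph.exists_imbalance_eq_of_odd (by omega) ho hx hs hk0
        (hk1.trans_eq hi.symm)
      exact ⟨z, hz, hzs, (abs_of_nonneg hk0).symm⟩
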